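/- Let $E=\{z\in\mathbb{C}:|z|<1\}$. A mapping $f=h+\overline g$ with $h,g$ analytic in $E$ is harmonic; it is called sense-preserving if $|h'|^2-|g'|^2>0$ in $E$. Let $S_H$ be the class of all univalent, sense-preserving harmonic mappings $f=h+\overline g$ of $E$ with $h(0)=g(0)=0$ and $h'(0)=1$. The convolution of $h_1+\overline{g_1}$ and $h_2+\overline{g_2}$ is $h_1\ast h_2+\overline{g_1\ast g_2}$, where $\left(\sum A_nz^n\right)\ast\left(\sum B_nz^n\right)=\sum A_nB_nz^n$. A set $\Omega\subseteq\mathbb{C}$ is convex in the horizontal direction if its intersection with every line parallel to the real axis is connected (possibly empty). For real $a$ with $|a|<1$ let $f_a=h_a+\overline{g_a}$, where $$h_a(z)=\frac{\frac{1}{1+a}z-\frac12z^2}{(1-z)^2},\qquad g_a(z)=\frac{\frac{a}{1+a}z-\frac12z^2}{(1-z)^2},$$ that is, $h_a+g_a=\frac{z}{1-z}$, $h_a(0)=g_a(0)=0$, and $f_a$ has dilatation $\frac{g_a'(z)}{h_a'(z)}=\frac{a-z}{1-az}$. **Corollary 2.4.** Let $a\in[-3+2\sqrt2,1)$. Then $f_a\ast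 f_a$ is a sense-preserving univalent harmonic mapping of $E$, its normalization $(1+a)^2\,(f_a\ast f_a)$ belongs to $S_H$, and the image $(f_a\ast f_a)(E)$ is convex in the horizontal direction. -/

import Mathlib

/-- The open unit disk `E` of the complex plane. -/
def unitDiskE : Set ℂ := Metric.ball (0 : ℂ) 1

/-- A planar mapping `f = h + conj g` written through its analytic part `h` and its
co-analytic part `g`. When `h` and `g` are analytic in `E` this is a harmonic mapping of `E`, and
every harmonic mapping of `E` has this form, uniquely if `g 0 = 0`. Only the values in `E` matter;
analyticity is part of the predicates below. -/
structure PlanarMap where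
  /-- the analytic part `h` -/
  h : ℂ → ℂ
  /-- the co-analytic part `g` -/
  g : ℂ → ℂ

namespace PlanarMap

/-- The mapping `f = h + conj g` itself. -/
def toFun (f : PlanarMap) (z : ℂ) : ℂ := f.h z + (starRingEnd ℂ) (f.g z)

/-- The image `f(E)` of the unit disk. -/
def image (f : PlanarMap) : Set ℂ := f.toFun '' unitDiskE

/-- The Jacobian `|h'|² - |g'|²`. -/
noncomputable def jacobian (f : PlanarMap) (z : ℂ) : ℝ := ‖deriv f.h z‖ ^ 2 - ‖deriv f.g z‖ ^ 2

/-- `f` is harmonic, sense-preserving and univalent in `E`. -/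
structure IsUnivalentHarmonic (f : PlanarMap) : Prop where
  analytic_h : DifferentiableOn ℂ f.h unitDiskE
  analytic_g : DifferentiableOn ℂ f.g unitDiskE
  sense_preserving : ∀ z ∈ unitDiskE, 0 < f.jacobian z
  univalent : Set.InjOn f.toFun unitDiskE

/-- The class `S_H`: harmonic, sense-preserving, univalent mappings of `E` of the form
`z + ∑_{n ≥ 2} a_n z^n + conj (∑_{n ≥ 1} b_n z^n)`. -/
structure MemSH (f : PlanarMap) : Prop extends IsUnivalentHarmonic f where
  h_zero : f.h 0 = 0
  g_zero : f.g 0 = 0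
  deriv_h_zero : deriv f.h 0 = 1

/-- The mapping `c f = c h + conj (c g)`, for a real constant `c`. -/
def scale (c : ℝ) (f : PlanarMap) : PlanarMap where
  h z := (c : ℂ) * f.h z
  g z := (c : ℂ) * f.g z

end PlanarMap

/-- The `n`-th Taylor coefficient of `F` at the origin. -/
noncomputable def taylorCoeffZero (F : ℂ → ℂ) (n : ℕ) : ℂ :=
  iteratedDeriv n F 0 / (n.factorial : ℂ)

/-- The Hadamard product `∑ A_n B_n z^n` of `F = ∑ A_n z^n` and `G = ∑ B_n z^n`. For `F`, `G`
analytic in `E` the series converges absolutely in `E`. -/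
noncomputable def hadamardProduct (F G : ℂ → ℂ) (z : ℂ) : ℂ :=
  ∑' n : ℕ, taylorCoeffZero F n * taylorCoeffZero G n * z ^ n

/-- The convolution `F ∗ f = (H ∗ h) + conj (G ∗ g)` of two harmonic mappings. -/
noncomputable def PlanarMap.conv (F f : PlanarMap) : PlanarMap where
  h := hadamardProduct F.h f.h
  g := hadamardProduct F.g f.g

/-- `Ω` is convex in the direction `φ`: each line parallel to the line through `0` and `e^{iφ}`
has connected (possibly empty) intersection with `Ω`. -/
def ConvexInDirection (φ : ℝ) (Ω : Set ℂ) : Prop :=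
  ∀ p : ℂ, IsPreconnected
    (Set.range (fun t : ℝ => p + (t : ℂ) * Complex.exp (φ * Complex.I)) ∩ Ω)

/-- Convexity in the horizontal direction (CHD). -/
def ConvexHorizontal (Ω : Set ℂ) : Prop := ConvexInDirection 0 Ω

/-- The right half-plane mapping `f_a = h_a + conj g_a`, the one with `h_a + g_a = z / (1 - z)`,
`h_a 0 = g_a 0 = 0` and dilatation `(a - z) / (1 - a z)`. Here `h_a' 0 = 1 / (1 + a)`. -/
noncomputable def halfPlaneMap (a : ℝ) : PlanarMap where
  h z := (1 / (1 + (a : ℂ)) * z - 1 / 2 * z ^ 2) / (1 - z) ^ 2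
  g z := ((a : ℂ) / (1 + (a : ℂ)) * z - 1 / 2 * z ^ 2) / (1 - z) ^ 2

/-! For n ≥ 1 the nth Taylor coefficients of h_a and g_a are 1/2 + bn and 1/2 - bn, where b =
(1-a)/(2(1+a)) > 0, so convolving f_a with itself just squares them and gives closed forms
(`hadamardProduct_self`). In the coordinate w = (1+z)/(1-z) = x + iy, x > 0, these are polynomials
in w. Passing from b to -b flips only the part odd in b, so adding the conjugate leaves twice the
real part of the even part plus 2i times the imaginary part of the odd part; the latter is i·b·xy
(`squaredCoeffSum_add_conj`). Horizontal lines therefore pull back to the connected curves xy =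
const, which gives convexity. Along each curve the real part increases strictly with x once b² ≤
1/2, which gives univalence. For a in (-1, 1) that bound says exactly a ≥ -3 + 2√2. -/

/-- A function that is the sum of a power series near the origin has the coefficients of the
series as its Taylor coefficients. -/
theorem taylorCoeffZero_eq_of_hasSum {F : ℂ → ℂ} {c : ℕ → ℂ}
    (hF : ∀ z : ℂ, ‖z‖ < 1 → HasSum (fun n => c n * z ^ n) (F z)) (n : ℕ) :
    taylorCoeffZero F n = c n := by
  have h1 : HasFPowerSeriesAt F (FormalMultilinearSeries.ofScalars ℂ c) 0 := by
    rw [hasFPowerSeriesAt_iff]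
    filter_upwards [Metric.ball_mem_nhds (0 : ℂ) one_pos] with z hz
    have := hF z (by simpa using hz)
    simpa [FormalMultilinearSeries.coeff_ofScalars, mul_comm] using this
  have h2 := h1.analyticAt.hasFPowerSeriesAt
  have h3 := congrArg (fun p => FormalMultilinearSeries.coeff p n)
    (h2.eq_formalMultilinearSeries h1)
  simpa [FormalMultilinearSeries.coeff_ofScalars, taylorCoeffZero] using h3

theorem one_sub_ne_zero_of_norm_lt_one {z : ℂ} (hz : ‖z‖ < 1) : 1 - z ≠ 0 := by
  intro h
  have : z = 1 := (sub_eq_zero.mp h).symm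
  simp [this] at hz

/-- `∑ n² zⁿ = z (1 + z) / (1 - z)³` in the unit disk. -/
theorem hasSum_sq_mul_geometric {z : ℂ} (hz : ‖z‖ < 1) :
    HasSum (fun n : ℕ => (n : ℂ) ^ 2 * z ^ n) (z * (1 + z) / (1 - z) ^ 3) := by
  have h0 := one_sub_ne_zero_of_norm_lt_one hz
  have h2 := hasSum_choose_mul_geometric_of_norm_lt_one 2 hz
  have h1 := hasSum_coe_mul_geometric_of_norm_lt_one hz
  have hg := hasSum_geometric_of_norm_lt_one hz
  -- n² = 2·C(n+2, 2) - 3n - 2.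
  have h := ((h2.mul_left 2).sub (h1.mul_left 3)).sub (hg.mul_left 2)
  convert h using 1
  · rfl
  · funext n
    have : ((n + 2).choose 2 : ℂ) = ((n : ℂ) + 2) * (n + 1) / 2 := by
      rw [Nat.cast_choose_two]
      push_cast
      ring
    rw [this]
    ring
  · field_simp
    ring

/-- The analytic function with Taylor coefficients `1 / 2 + β n` for `n ≥ 1`. -/
theorem hasSum_half_add_mul {z : ℂ} (β : ℂ) (hz : ‖z‖ < 1) :
    HasSum (fun n : ℕ => (if n = 0 then 0 else 1 / 2 + β * n) * z ^ n)
      (1 / 2 * (z / (1 - z)) + β * (z / (1 - z) ^ 2)) := by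
  have h0 := one_sub_ne_zero_of_norm_lt_one hz
  have h1 := hasSum_coe_mul_geometric_of_norm_lt_one hz
  have hg := hasSum_geometric_of_norm_lt_one hz
  -- Removes the constant term 1/2 that the full geometric series contributes at n = 0.
  have hs := hasSum_ite_eq (0 : ℕ) (1 / 2 : ℂ)
  convert ((hg.mul_left (1 / 2)).add (h1.mul_left β)).sub hs using 1
  · rfl
  · funext n
    rcases eq_or_ne n 0 with rfl | hn
    · simp
    · simp only [hn, if_false]
      ring
  · field_simp
    ring

/-- The analytic function with Taylor coefficients `(1 / 2 + β n)²` for `n ≥ 1`. -/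
noncomputable def squaredCoeffSum (β z : ℂ) : ℂ :=
  1 / 4 * (z / (1 - z)) + β * (z / (1 - z) ^ 2) + β ^ 2 * (z * (1 + z) / (1 - z) ^ 3)

theorem hadamardProduct_self {F : ℂ → ℂ} {β : ℂ}
    (hF : ∀ z : ℂ, ‖z‖ < 1 → F z = 1 / 2 * (z / (1 - z)) + β * (z / (1 - z) ^ 2))
    {z : ℂ} (hz : ‖z‖ < 1) : hadamardProduct F F z = squaredCoeffSum β z := by
  have hc := taylorCoeffZero_eq_of_hasSum (F := F)
    (c := fun n : ℕ => if n = 0 then 0 else 1 / 2 + β * n)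
    (fun z hz => by rw [hF z hz]; exact hasSum_half_add_mul β hz)
  have h0 := one_sub_ne_zero_of_norm_lt_one hz
  have h1 := hasSum_coe_mul_geometric_of_norm_lt_one hz
  have hg := hasSum_geometric_of_norm_lt_one hz
  have hs := hasSum_ite_eq (0 : ℕ) (1 / 4 : ℂ)
  have h := (((hg.mul_left (1 / 4)).add (h1.mul_left β)).add
    ((hasSum_sq_mul_geometric hz).mul_left (β ^ 2))).sub hs
  unfold hadamardProduct
  simp only [hc]
  refine HasSum.tsum_eq ?_
  convert h using 1
  · rfl
  · funext n
    rcases eq_or_ne n 0 with rfl | hn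
    · simp
    · simp only [hn, if_false]
      ring
  · unfold squaredCoeffSum
    field_simp
    ring

theorem hasDerivAt_squaredCoeffSum (β : ℂ) {z : ℂ} (hz : ‖z‖ < 1) :
    HasDerivAt (squaredCoeffSum β)
      (1 / 4 / (1 - z) ^ 2 + β * (1 + z) / (1 - z) ^ 3
        + β ^ 2 * (1 + 4 * z + z ^ 2) / (1 - z) ^ 4) z := by
  have h0 := one_sub_ne_zero_of_norm_lt_one hz
  have hid := hasDerivAt_id z
  have hd : HasDerivAt (fun z : ℂ => 1 - z) (-1) z := by simpa using hid.const_sub 1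
  have hp : HasDerivAt (fun z : ℂ => 1 + z) 1 z := by simpa using hid.const_add 1
  have e1 := (hid.div hd h0).const_mul (1 / 4)
  have e2 := (hid.div (hd.pow 2) (pow_ne_zero 2 h0)).const_mul β
  have e3 := ((hid.mul hp).div (hd.pow 3) (pow_ne_zero 3 h0)).const_mul (β ^ 2)
  refine ((e1.add e2).add e3).congr_deriv ?_
  simp only [id, Pi.pow_apply, Pi.mul_apply]
  field_simp
  ring

/-! ### The right half-plane coordinate -/

/-- The Cayley transform of the unit disk onto the right half-plane. -/
theorem cayley_re_pos {z : ℂ} (hz : ‖z‖ < 1) : 0 < ((1 + z) / (1 - z)).re := by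
  have h0 := one_sub_ne_zero_of_norm_lt_one hz
  have h1 : 0 < Complex.normSq (1 - z) := Complex.normSq_pos.mpr h0
  have h2 : Complex.normSq z < 1 := by
    rw [Complex.normSq_eq_norm_sq]
    nlinarith [norm_nonneg z]
  rw [Complex.div_re, ← add_div]
  refine div_pos ?_ h1
  rw [Complex.normSq_apply] at h2
  simp
  nlinarith

theorem cayley_inv_norm_lt_one {w : ℂ} (hw : 0 < w.re) : ‖(w - 1) / (w + 1)‖ < 1 := by
  have hne : w + 1 ≠ 0 := by
    intro h
    have := congrArg Complex.re h
    simp at this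
    linarith
  rw [norm_div, div_lt_one (norm_pos_iff.mpr hne)]
  refine lt_of_pow_lt_pow_left₀ 2 (norm_nonneg _) ?_
  rw [← Complex.normSq_eq_norm_sq, ← Complex.normSq_eq_norm_sq, Complex.normSq_apply,
    Complex.normSq_apply]
  simp
  nlinarith

theorem cayley_cayley_inv {w : ℂ} (hw : 0 < w.re) :
    (1 + (w - 1) / (w + 1)) / (1 - (w - 1) / (w + 1)) = w := by
  have hne : w + 1 ≠ 0 := by
    intro h
    have := congrArg Complex.re h
    simp at this
    linarith
  have h2 : 1 - (w - 1) / (w + 1) ≠ 0 :=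
    one_sub_ne_zero_of_norm_lt_one (cayley_inv_norm_lt_one hw)
  rw [div_eq_iff h2]
  field_simp
  ring

/-- The harmonic mapping `z ↦ squaredCoeffSum b z + conj (squaredCoeffSum (-b) z)` written in the
right half-plane coordinate. -/
noncomputable def halfPlaneShear (b : ℝ) (x y : ℝ) : ℂ :=
  ⟨(1 / 4 - b ^ 2 / 2) * x + b ^ 2 / 2 * (x ^ 3 - 3 * x * y ^ 2) - 1 / 4, b * (x * y)⟩

theorem squaredCoeffSum_add_conj (b : ℝ) {z : ℂ} (hz : ‖z‖ < 1) :
    squaredCoeffSum b z + (starRingEnd ℂ) (squaredCoeffSum (-b) z)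
      = halfPlaneShear b ((1 + z) / (1 - z)).re ((1 + z) / (1 - z)).im := by
  have h0 := one_sub_ne_zero_of_norm_lt_one hz
  set w := (1 + z) / (1 - z) with hw
  -- Uses z/(1-z) = (w-1)/2 and z/(1-z)² = (w²-1)/4; the third term is w times the second.
  have key : ∀ β : ℂ, squaredCoeffSum β z
      = 1 / 4 * ((w - 1) / 2) + β * ((w ^ 2 - 1) / 4) + β ^ 2 * (w * (w ^ 2 - 1) / 4) := by
    intro β
    rw [hw]
    unfold squaredCoeffSum
    field_simp
    ring
  rw [key, key]
  clear_value w
  obtain ⟨x, y⟩ := w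
  have e : (1 / 4 * (((⟨x, y⟩ : ℂ) - 1) / 2)) = ⟨(x - 1) / 8, y / 8⟩ := by
    apply Complex.ext <;> simp <;> ring
  have e2 : ((⟨x, y⟩ : ℂ) ^ 2 - 1) / 4 = ⟨(x ^ 2 - y ^ 2 - 1) / 4, x * y / 2⟩ := by
    apply Complex.ext <;> simp [pow_two] <;> ring
  have e3 : ((⟨x, y⟩ : ℂ) * ((⟨x, y⟩ : ℂ) ^ 2 - 1) / 4) =
      ⟨(x ^ 3 - 3 * x * y ^ 2 - x) / 4, (3 * x ^ 2 * y - y ^ 3 - y) / 4⟩ := by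
    rw [mul_div_assoc, e2]
    apply Complex.ext <;> simp <;> ring
  rw [e, e2, e3]
  apply Complex.ext
  · simp [halfPlaneShear, pow_two]
    ring
  · simp [halfPlaneShear, pow_two]
    ring

/-- Equal imaginary parts fix c = xy. Then xy² = c²/x does not increase with x while x³ strictly
increases, and b² ≤ 1/2 keeps the linear coefficient nonnegative, so the real part determines x. -/
theorem halfPlaneShear_injective {b : ℝ} (hb : 0 < b) (hb2 : b ^ 2 ≤ 1 / 2)
    {x y x' y' : ℝ} (hx : 0 < x) (hx' : 0 < x')
    (h : halfPlaneShear b x y = halfPlaneShear b x' y') : x = x' ∧ y = y' := by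
  have him : x * y = x' * y' := mul_left_cancel₀ hb.ne' (congrArg Complex.im h)
  have hre := congrArg Complex.re h
  simp only [halfPlaneShear] at hre
  have aux : ∀ {x y x' y' : ℝ}, 0 < x → 0 < x' → x * y = x' * y' → x < x' →
      (1 / 4 - b ^ 2 / 2) * x + b ^ 2 / 2 * (x ^ 3 - 3 * x * y ^ 2)
        < (1 / 4 - b ^ 2 / 2) * x' + b ^ 2 / 2 * (x' ^ 3 - 3 * x' * y' ^ 2) := by
    intro x y x' y' hx hx' him hlt
    have h1 : (1 / 4 - b ^ 2 / 2) * x ≤ (1 / 4 - b ^ 2 / 2) * x' :=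
      mul_le_mul_of_nonneg_left hlt.le (by linarith)
    have h2 : x ^ 3 < x' ^ 3 := pow_lt_pow_left₀ hlt hx.le (by norm_num)
    have h3 : x' * y' ^ 2 ≤ x * y ^ 2 := by
      have e1 : x' * y' ^ 2 = (x * y) ^ 2 / x' := by rw [him]; field_simp
      have e2 : x * y ^ 2 = (x * y) ^ 2 / x := by field_simp
      rw [e1, e2]
      exact div_le_div_of_nonneg_left (sq_nonneg _) hx hlt.le
    have h4 : b ^ 2 / 2 * (x ^ 3 - 3 * x * y ^ 2) < b ^ 2 / 2 * (x' ^ 3 - 3 * x' * y' ^ 2) :=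
      mul_lt_mul_of_pos_left (by linarith) (by positivity)
    linarith
  have hxx : x = x' := by
    rcases lt_trichotomy x x' with hlt | heq | hlt
    · have := aux hx hx' him hlt
      linarith
    · exact heq
    · have := aux hx' hx him.symm hlt
      linarith
  subst hxx
  exact ⟨rfl, mul_left_cancel₀ hx.ne' him⟩

/-- The image of the right half-plane under `halfPlaneShear` is convex in the horizontal
direction. -/
theorem convexHorizontal_halfPlaneShear {b : ℝ} (hb : 0 < b) :
    ConvexHorizontal {p | ∃ x y : ℝ, 0 < x ∧ halfPlaneShear b x y = p} := by
  intro p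
  -- The line at height Im p pulls back to the graph y = Im p/(bx), a continuous image of the
  -- interval x > 0; no monotonicity is needed.
  have hset : Set.range (fun t : ℝ => p + (t : ℂ) * Complex.exp ((0 : ℝ) * Complex.I)) ∩
      {p | ∃ x y : ℝ, 0 < x ∧ halfPlaneShear b x y = p}
      = (fun x : ℝ => halfPlaneShear b x (p.im / b / x)) '' Set.Ioi 0 := by
    ext q
    constructor
    · rintro ⟨⟨t, rfl⟩, x, y, hx, hq⟩
      refine ⟨x, hx, ?_⟩
      have him := congrArg Complex.im hq
      simp [halfPlaneShear] at him
      have hy : p.im / b / x = y := by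
        rw [← him]
        field_simp
      simp only [hy]
      exact hq
    · rintro ⟨x, hx, rfl⟩
      have hx : 0 < x := hx
      refine ⟨⟨(halfPlaneShear b x (p.im / b / x)).re - p.re, ?_⟩, x, _, hx, rfl⟩
      apply Complex.ext
      · simp
      · have him : (halfPlaneShear b x (p.im / b / x)).im = p.im := by
          simp only [halfPlaneShear]
          field_simp
        rw [him]
        simp
  rw [hset]
  refine isPreconnected_Ioi.image _ ?_
  have hy : ContinuousOn (fun x : ℝ => p.im / b / x) (Set.Ioi 0) :=
    continuousOn_const.div continuousOn_id fun x hx => (ne_of_gt hx)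
  have hF : Continuous fun q : ℝ × ℝ => halfPlaneShear b q.1 q.2 := by
    have : (fun q : ℝ × ℝ => halfPlaneShear b q.1 q.2) = fun q => Complex.equivRealProdCLM.symm
        ((1 / 4 - b ^ 2 / 2) * q.1 + b ^ 2 / 2 * (q.1 ^ 3 - 3 * q.1 * q.2 ^ 2) - 1 / 4,
          b * (q.1 * q.2)) := rfl
    rw [this]
    exact Complex.equivRealProdCLM.symm.continuous.comp (by fun_prop)
  exact hF.comp_continuousOn (continuousOn_id.prodMk hy)

/-! ### Positivity of the Jacobian -/

theorem norm_sq_add_sub_norm_sq_sub (P Q : ℂ) :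
    ‖P + Q‖ ^ 2 - ‖P - Q‖ ^ 2 = 4 * (P * (starRingEnd ℂ) Q).re := by
  simp only [← Complex.normSq_eq_norm_sq, Complex.normSq_apply]
  simp
  ring

theorem norm_sq_deriv_squaredCoeffSum_sub_pos {b : ℝ} (hb : 0 < b) (hb2 : b ^ 2 ≤ 1 / 2)
    {z : ℂ} (hz : ‖z‖ < 1) :
    0 < ‖deriv (squaredCoeffSum b) z‖ ^ 2 - ‖deriv (squaredCoeffSum (-b)) z‖ ^ 2 := by
  have h0 := one_sub_ne_zero_of_norm_lt_one hz
  rw [(hasDerivAt_squaredCoeffSum _ hz).deriv, (hasDerivAt_squaredCoeffSum _ hz).deriv]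
  have hx := cayley_re_pos hz
  set w := (1 + z) / (1 - z) with hw
  -- Chain rule form: 1/(1-z)² is half of dw/dz. The bracket splits into P, even in b, and Q = bw,
  -- odd in b, so the Jacobian is a positive multiple of Re(P·conj Q).
  have e1 : 1 / 4 / (1 - z) ^ 2 + (b : ℂ) * (1 + z) / (1 - z) ^ 3
        + (b : ℂ) ^ 2 * (1 + 4 * z + z ^ 2) / (1 - z) ^ 4
      = (1 / (1 - z) ^ 2) * ((1 / 4 - b ^ 2 / 2 + 3 / 2 * b ^ 2 * w ^ 2) + b * w) := by
    rw [hw]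
    field_simp
    ring
  have e2 : 1 / 4 / (1 - z) ^ 2 + (-b : ℂ) * (1 + z) / (1 - z) ^ 3
        + (-b : ℂ) ^ 2 * (1 + 4 * z + z ^ 2) / (1 - z) ^ 4
      = (1 / (1 - z) ^ 2) * ((1 / 4 - b ^ 2 / 2 + 3 / 2 * b ^ 2 * w ^ 2) - b * w) := by
    rw [hw]
    field_simp
    ring
  rw [e1, e2, norm_mul, norm_mul, mul_pow, mul_pow, ← mul_sub, norm_sq_add_sub_norm_sq_sub]
  have hn : 0 < ‖1 / (1 - z) ^ 2‖ := norm_pos_iff.mpr (one_div_ne_zero (pow_ne_zero 2 h0))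
  refine mul_pos (pow_pos hn 2) (mul_pos four_pos ?_)
  clear_value w
  obtain ⟨x, y⟩ := w
  simp only at hx
  have : (((1 / 4 - (b : ℂ) ^ 2 / 2 + 3 / 2 * b ^ 2 * (⟨x, y⟩ : ℂ) ^ 2)) *
      (starRingEnd ℂ) (b * (⟨x, y⟩ : ℂ))).re
      = b * x * ((1 / 4 - b ^ 2 / 2) + 3 / 2 * b ^ 2 * (x ^ 2 + y ^ 2)) := by
    have e : (1 / 4 - (b : ℂ) ^ 2 / 2 + 3 / 2 * b ^ 2 * (⟨x, y⟩ : ℂ) ^ 2) =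
        ⟨1 / 4 - b ^ 2 / 2 + 3 / 2 * b ^ 2 * (x ^ 2 - y ^ 2), 3 * b ^ 2 * (x * y)⟩ := by
      have e' : (⟨x, y⟩ : ℂ) ^ 2 = ⟨x ^ 2 - y ^ 2, 2 * (x * y)⟩ := by
        apply Complex.ext <;> simp [pow_two] <;> ring
      have eb : 1 / 4 - (b : ℂ) ^ 2 / 2 = ((1 / 4 - b ^ 2 / 2 : ℝ) : ℂ) := by push_cast; ring
      have ec : 3 / 2 * (b : ℂ) ^ 2 = ((3 / 2 * b ^ 2 : ℝ) : ℂ) := by push_cast; ring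
      rw [e', eb, ec]
      apply Complex.ext
      · rw [Complex.add_re, Complex.ofReal_re, Complex.re_ofReal_mul]
      · rw [Complex.add_im, Complex.ofReal_im, Complex.im_ofReal_mul]
        ring
    rw [e]
    simp
    ring
  rw [this]
  have : 0 < 3 / 2 * b ^ 2 * (x ^ 2 + y ^ 2) := by positivity
  exact mul_pos (mul_pos hb hx) (by linarith)

/-! ### Transfer to harmonic mappings of the disk -/

theorem mem_unitDiskE {z : ℂ} : z ∈ unitDiskE ↔ ‖z‖ < 1 := by
  simp [unitDiskE]

theorem deriv_eq_of_eqOn_unitDiskE {F G : ℂ → ℂ} (h : Set.EqOn F G unitDiskE) {z : ℂ}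
    (hz : z ∈ unitDiskE) : deriv F z = deriv G z :=
  (h.eventuallyEq_of_mem (Metric.isOpen_ball.mem_nhds hz)).deriv_eq

theorem differentiableOn_squaredCoeffSum (β : ℂ) :
    DifferentiableOn ℂ (squaredCoeffSum β) unitDiskE := fun _ hz =>
  (hasDerivAt_squaredCoeffSum β (mem_unitDiskE.mp hz)).differentiableAt.differentiableWithinAt

namespace PlanarMap

variable {f : PlanarMap} {b : ℝ}

theorem toFun_eq_halfPlaneShear (hh : Set.EqOn f.h (squaredCoeffSum b) unitDiskE)
    (hg : Set.EqOn f.g (squaredCoeffSum (-b)) unitDiskE) {z : ℂ} (hz : z ∈ unitDiskE) :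
    f.toFun z = halfPlaneShear b ((1 + z) / (1 - z)).re ((1 + z) / (1 - z)).im := by
  rw [toFun, hh hz, hg hz, squaredCoeffSum_add_conj b (mem_unitDiskE.mp hz)]

theorem isUnivalentHarmonic_of_eqOn (hb : 0 < b) (hb2 : b ^ 2 ≤ 1 / 2)
    (hh : Set.EqOn f.h (squaredCoeffSum b) unitDiskE)
    (hg : Set.EqOn f.g (squaredCoeffSum (-b)) unitDiskE) : f.IsUnivalentHarmonic where
  analytic_h := (differentiableOn_squaredCoeffSum _).congr hh
  analytic_g := (differentiableOn_squaredCoeffSum _).congr hg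
  sense_preserving z hz := by
    rw [jacobian, deriv_eq_of_eqOn_unitDiskE hh hz, deriv_eq_of_eqOn_unitDiskE hg hz]
    exact norm_sq_deriv_squaredCoeffSum_sub_pos hb hb2 (mem_unitDiskE.mp hz)
  univalent z hz z' hz' h := by
    rw [toFun_eq_halfPlaneShear hh hg hz, toFun_eq_halfPlaneShear hh hg hz'] at h
    have hz := mem_unitDiskE.mp hz
    have hz' := mem_unitDiskE.mp hz'
    obtain ⟨h1, h2⟩ := halfPlaneShear_injective hb hb2 (cayley_re_pos hz) (cayley_re_pos hz') h
    have h3 := Complex.ext h1 h2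
    rw [div_eq_div_iff (one_sub_ne_zero_of_norm_lt_one hz)
      (one_sub_ne_zero_of_norm_lt_one hz')] at h3
    linear_combination h3 / 2

theorem image_eq_of_eqOn (hh : Set.EqOn f.h (squaredCoeffSum b) unitDiskE)
    (hg : Set.EqOn f.g (squaredCoeffSum (-b)) unitDiskE) :
    f.image = {p | ∃ x y : ℝ, 0 < x ∧ halfPlaneShear b x y = p} := by
  ext p
  constructor
  · rintro ⟨z, hz, rfl⟩
    exact ⟨_, _, cayley_re_pos (mem_unitDiskE.mp hz), (toFun_eq_halfPlaneShear hh hg hz).symm⟩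
  · rintro ⟨x, y, hx, rfl⟩
    have hw : 0 < (⟨x, y⟩ : ℂ).re := hx
    have hz := mem_unitDiskE.mpr (cayley_inv_norm_lt_one hw)
    refine ⟨_, hz, ?_⟩
    rw [toFun_eq_halfPlaneShear hh hg hz, cayley_cayley_inv hw]

theorem IsUnivalentHarmonic.scale {c : ℝ} (hc : 0 < c) (hf : f.IsUnivalentHarmonic) :
    (f.scale c).IsUnivalentHarmonic where
  analytic_h := hf.analytic_h.const_mul _
  analytic_g := hf.analytic_g.const_mul _
  sense_preserving z hz := by
    have := hf.sense_preserving z hz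
    have e : (f.scale c).jacobian z = c ^ 2 * f.jacobian z := by
      simp only [jacobian, PlanarMap.scale, deriv_const_mul_field, norm_mul, mul_pow,
        Complex.norm_real, Real.norm_eq_abs, sq_abs]
      ring
    rw [e]
    positivity
  univalent z hz z' hz' h := by
    refine hf.univalent hz hz' ?_
    have e : ∀ z, (f.scale c).toFun z = c * f.toFun z := fun z => by
      simp [toFun, PlanarMap.scale, mul_add]
    rw [e, e] at h
    exact mul_left_cancel₀ (Complex.ofReal_ne_zero.mpr hc.ne') h

end PlanarMap

theorem halfPlaneMap_conv_self {a : ℝ} (ha : -1 < a) :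
    Set.EqOn ((halfPlaneMap a).conv (halfPlaneMap a)).h
      (squaredCoeffSum ((1 - a) / (2 * (1 + a)) : ℝ)) unitDiskE ∧
    Set.EqOn ((halfPlaneMap a).conv (halfPlaneMap a)).g
      (squaredCoeffSum (-((1 - a) / (2 * (1 + a)) : ℝ))) unitDiskE := by
  have hne : (1 + a : ℂ) ≠ 0 := by
    have : (1 + a : ℝ) ≠ 0 := by linarith
    exact_mod_cast this
  constructor <;> intro z hz <;>
  · refine hadamardProduct_self (fun z hz => ?_) (mem_unitDiskE.mp hz)
    have h0 := one_sub_ne_zero_of_norm_lt_one hz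
    simp only [halfPlaneMap]
    push_cast
    field_simp
    ring

theorem corollary2p4 (a : ℝ) (ha : a ∈ Set.Ico (-3 + 2 * Real.sqrt 2) 1) :
    ((halfPlaneMap a).conv (halfPlaneMap a)).IsUnivalentHarmonic ∧
    (((halfPlaneMap a).conv (halfPlaneMap a)).scale ((1 + a) ^ 2)).MemSH ∧
    ConvexHorizontal ((halfPlaneMap a).conv (halfPlaneMap a)).image := by
  obtain ⟨ha1, ha2⟩ := ha
  have hs : Real.sqrt 2 ^ 2 = 2 := Real.sq_sqrt (by norm_num)
  have hs0 : 1 < Real.sqrt 2 := by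
    rw [Real.lt_sqrt] <;> norm_num
  have ham : -1 < a := by linarith
  have hb : 0 < (1 - a) / (2 * (1 + a)) := div_pos (by linarith) (by linarith)
  -- Equivalent to a² + 6a + 1 ≥ 0, whose larger root is -3 + 2√2.
  have hb2 : ((1 - a) / (2 * (1 + a))) ^ 2 ≤ 1 / 2 := by
    rw [div_pow, div_le_div_iff₀ (pow_pos (by linarith) 2) two_pos]
    nlinarith
  obtain ⟨hh, hg⟩ := halfPlaneMap_conv_self ham
  have hU := PlanarMap.isUnivalentHarmonic_of_eqOn hb hb2 hh hg
  have h0 : (0 : ℂ) ∈ unitDiskE := mem_unitDiskE.mpr (by simp)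
  refine ⟨hU, ⟨hU.scale (pow_pos (by linarith) 2), ?_, ?_, ?_⟩, ?_⟩
  · simp [PlanarMap.scale, hh h0, squaredCoeffSum]
  · simp [PlanarMap.scale, hg h0, squaredCoeffSum]
  · have hne : (1 + a : ℂ) ≠ 0 := by
      have : (1 + a : ℝ) ≠ 0 := by linarith
      exact_mod_cast this
    simp only [PlanarMap.scale, deriv_const_mul_field]
    -- The derivative at 0 is (1/2 + b)², and 1/2 + b = 1/(1+a); hence the factor (1+a)².
    rw [deriv_eq_of_eqOn_unitDiskE hh h0,
      (hasDerivAt_squaredCoeffSum _ (mem_unitDiskE.mp h0)).deriv]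
    push_cast
    field_simp
    ring
  · rw [PlanarMap.image_eq_of_eqOn hh hg]
    exact convexHorizontal_halfPlaneShear hb
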